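/- Let $n$ be a natural number, $\alpha \in (0,1)$, $v \in \mathbb{R}^n$ and $R \in \mathbb{R}^{n\times n^2}$ with $v \ge 0$, $R \ge 0$ (entrywise), $\mathbf{1}_n^\top v = 1$ and $\mathbf{1}_n^\top R = \mathbf{1}_{n^2}^\top$, where $\mathbf{1}$ denotes the all-ones column vector. Let $G(x) = \alpha R(x \otimes x) + (1-\alpha) v$ for $x \in \mathbb{R}^n$, where $\otimes$ is the Kronecker product. Then: 1. for $u = 1$ and for $u = \frac{1-\alpha}{\alpha}$, the map $G$ sends the level set $\ell_u = \{x \in \mathbb{R}^n : x \ge 0,\ \mathbf{1}^\top x = u\}$ into itself; 2. the multilinear PageRank equation $x = \alpha R(x\otimes x) + (1-\alpha) v$ has a solution $x \ge 0$ with $\mathbf{1}^\top x = 1$ (a stochastic solution), and a solution $x \ge 0$ with $\mathbf{1}^\top x = \frac{1-\alpha}{\alpha}$. (The two solutions are not claimed to be different; for $\alpha = \frac12$ the two level sets coincide.) -/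

import Mathlib

open scoped Matrix

namespace MultilinearPageRank

/-- The Kronecker product `x ⊗ y` of two vectors, a vector with `n²` entries, indexed by the
pairs `(i, j)`, as in Mathlib's Kronecker product of matrices. -/
def kronVec {n : ℕ} (x y : Fin n → ℝ) : Fin n × Fin n → ℝ :=
  fun p => x p.1 * y p.2

/-- The map `G(x) = α R (x ⊗ x) + (1 - α) v`. -/
def G {n : ℕ} (α : ℝ) (R : Matrix (Fin n) (Fin n × Fin n) ℝ) (v : Fin n → ℝ)
    (x : Fin n → ℝ) : Fin n → ℝ :=
  α • (R *ᵥ kronVec x x) + (1 - α) • v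

/-- `x` solves the multilinear PageRank equation `x = α R (x ⊗ x) + (1 - α) v`. -/
def IsSolution {n : ℕ} (α : ℝ) (R : Matrix (Fin n) (Fin n × Fin n) ℝ) (v : Fin n → ℝ)
    (x : Fin n → ℝ) : Prop :=
  x = α • (R *ᵥ kronVec x x) + (1 - α) • v

/-- The level set `{x : 1ᵀ x = u, x ≥ 0}`, with the componentwise order. -/
def levelSet (n : ℕ) (u : ℝ) : Set (Fin n → ℝ) :=
  {x | (1 : Fin n → ℝ) ⬝ᵥ x = u ∧ 0 ≤ x}

end MultilinearPageRank

open MeasureTheory Metric Set Filter Topology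

/-! ### Determinant interpolation and small perturbations of the identity. -/

section Brouwer

/-! On a level set of total `u`, the entries of `G x` sum to `α u² + 1 - α`, which equals `u`
exactly for `u = 1` and `u = (1 - α) / α`. So `G` maps each of these two simplices to itself, and
Brouwer gives a fixed point in each.

Brouwer rests on `no_contDiff_retraction`. If `id + h` were a `C¹` retraction of a ball onto its
sphere, `id + t h` would permute the open ball for small `t > 0`, so `∫ det (1 + t h')` would be the
volume of the ball. The integrand is polynomial in `t`, so interpolation carries this value to `t =
1`, where the determinant vanishes. -/

/-- The determinant of `1 + A` is a fixed affine combination of the determinants of `1 + t i • A`,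
for suitable small positive `t i`. -/
theorem exists_det_one_add_eq_sum (E : Type*) [NormedAddCommGroup E] [NormedSpace ℝ E]
    [FiniteDimensional ℝ E] {δ : ℝ} (hδ : 0 < δ) :
    ∃ (m : ℕ) (t c : Fin m → ℝ), (∀ i, 0 < t i ∧ t i < δ) ∧ ∑ i, c i = 1 ∧
      ∀ A : E →L[ℝ] E, (1 + A).det = ∑ i, c i * (1 + t i • A).det := by
  classical
  set d := Module.finrank ℝ E
  -- `d + 1` distinct nodes determine a polynomial of degree at most `d`; the offset `2` keeps every
  -- node below `δ`.
  let t : Fin (d + 1) → ℝ := fun i => δ / ((i : ℕ) + 2)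
  have ht : InjOn t (Finset.univ : Finset (Fin (d + 1))) := by
    intro i _ j _ hij
    have h1 : ((i : ℕ) + 2 : ℝ) ≠ 0 := by positivity
    have h2 : ((j : ℕ) + 2 : ℝ) ≠ 0 := by positivity
    simp only [t] at hij
    rw [div_eq_div_iff h1 h2] at hij
    have := mul_left_cancel₀ hδ.ne' hij
    apply Fin.ext
    exact_mod_cast (by linarith : ((i : ℕ) : ℝ) = (j : ℕ))
  -- Lagrange weights extrapolating from the nodes to `1`; they do not depend on `A`.
  refine ⟨d + 1, t, fun i => (Lagrange.basis Finset.univ t i).eval 1, fun i => ⟨?_, ?_⟩, ?_, ?_⟩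
  · positivity
  · have : (0 : ℝ) ≤ (i : ℕ) := by positivity
    simp only [t]
    rw [div_lt_iff₀ (by positivity)]
    nlinarith
  · rw [← Polynomial.eval_finsetSum, Lagrange.sum_basis ht ⟨0, Finset.mem_univ _⟩,
      Polynomial.eval_one]
  · intro A
    let b := Module.finBasis ℝ E
    let M := LinearMap.toMatrix b b (A : E →ₗ[ℝ] E)
    let p : Polynomial ℝ := ((Polynomial.X : Polynomial ℝ) • M.map Polynomial.C +
      (1 : Matrix (Fin d) (Fin d) ℝ).map Polynomial.C).det
    have hp : ∀ s : ℝ, p.eval s = (1 + s • A).det := by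
      intro s
      have h1 : (1 + s • A).det = (LinearMap.toMatrix b b ((1 + s • A : E →L[ℝ] E) : E →ₗ[ℝ] E)).det :=
        (LinearMap.det_toMatrix b _).symm
      have h2 : LinearMap.toMatrix b b ((1 + s • A : E →L[ℝ] E) : E →ₗ[ℝ] E) = s • M + 1 := by
        have : ((1 + s • A : E →L[ℝ] E) : E →ₗ[ℝ] E) = s • (A : E →ₗ[ℝ] E) + LinearMap.id := by
          ext x; simp [add_comm]
        rw [this, map_add, map_smul, LinearMap.toMatrix_id]
      rw [h1, h2]
      simp only [p]
      rw [← Polynomial.coe_evalRingHom, RingHom.map_det]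
      congr 1
      ext i j
      simp only [RingHom.mapMatrix_apply, Matrix.map_apply, Matrix.add_apply, Matrix.smul_apply,
        smul_eq_mul, map_add, Polynomial.coe_evalRingHom, Polynomial.eval_mul, Polynomial.eval_X,
        Polynomial.eval_C]
    have hdeg : p.degree < (Finset.univ : Finset (Fin (d + 1))).card := by
      refine lt_of_le_of_lt Polynomial.degree_le_natDegree ?_
      have := Polynomial.natDegree_det_X_add_C_le M 1
      simp only [Fintype.card_fin] at this
      simp only [Finset.card_univ, Fintype.card_fin]
      exact_mod_cast Nat.lt_succ_of_le this
    have key := congrArg (Polynomial.eval 1) (Lagrange.eq_interpolate ht hdeg)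
    rw [Lagrange.interpolate_apply, Polynomial.eval_finsetSum, hp, one_smul] at key
    rw [key]
    refine Finset.sum_congr rfl fun i _ => ?_
    rw [Polynomial.eval_mul, Polynomial.eval_C, hp, mul_comm]

variable {E : Type*} [NormedAddCommGroup E] [InnerProductSpace ℝ E]

/-- A segment leaving the ball crosses the sphere, where `h` vanishes. The extension by zero lets
the contraction principle run on all of `E`. -/
theorem lipschitzWith_indicator_closedBall {ρ : ℝ} {C : NNReal} {h : E → E}
    (hL : LipschitzOnWith C h (closedBall 0 ρ)) (h0 : ∀ x ∈ sphere (0 : E) ρ, h x = 0) :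
    LipschitzWith C ((closedBall 0 ρ).indicator h) := by
  have key : ∀ x ∈ closedBall (0 : E) ρ, ∀ y ∉ closedBall (0 : E) ρ, ‖h x‖ ≤ C * dist x y := by
    intro x hx y hy
    rw [mem_closedBall_zero_iff] at hx hy
    have hc : ContinuousOn (fun s : ℝ => ‖AffineMap.lineMap x y s‖) (Icc 0 1) := by
      have : Continuous (fun s : ℝ => (AffineMap.lineMap x y s : E)) :=
        AffineMap.lineMap_continuous
      exact this.norm.continuousOn
    obtain ⟨s, hs, hsρ⟩ := intermediate_value_Icc zero_le_one hc
      (show ρ ∈ Icc _ _ by simp only [AffineMap.lineMap_apply_zero,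
        AffineMap.lineMap_apply_one]; exact ⟨hx, (not_le.1 hy).le⟩)
    have hz : (AffineMap.lineMap x y s : E) ∈ sphere (0 : E) ρ := by simpa using hsρ
    have := hL.dist_le_mul x (by simpa using hx) _ (sphere_subset_closedBall hz)
    rw [h0 _ hz, dist_zero_right] at this
    refine this.trans (mul_le_mul_of_nonneg_left ?_ C.2)
    rw [dist_left_lineMap, Real.norm_of_nonneg hs.1]
    exact mul_le_of_le_one_left dist_nonneg hs.2
  refine LipschitzWith.of_dist_le_mul fun x y => ?_
  by_cases hx : x ∈ closedBall (0 : E) ρ <;> by_cases hy : y ∈ closedBall (0 : E) ρ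
  · rw [indicator_of_mem hx, indicator_of_mem hy]
    exact hL.dist_le_mul x hx y hy
  · rw [indicator_of_mem hx, indicator_of_notMem hy, dist_zero_right]
    exact key x hx y hy
  · rw [indicator_of_notMem hx, indicator_of_mem hy, dist_zero_left, dist_comm]
    exact key y hy x hx
  · rw [indicator_of_notMem hx, indicator_of_notMem hy, dist_self]
    positivity

/-- For small `t`, the perturbation `x + t h(x)` is a bijection of the ball, if `h` is Lipschitz
on the ball, vanishes on the sphere, and `x + h(x)` stays in the ball. -/
theorem bijOn_ball_add_smul [CompleteSpace E] {ρ : ℝ} {C : NNReal} {h : E → E}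
    (hL : LipschitzOnWith C h (closedBall 0 ρ)) (h0 : ∀ x ∈ sphere (0 : E) ρ, h x = 0)
    (hm : ∀ x ∈ closedBall (0 : E) ρ, x + h x ∈ closedBall (0 : E) ρ)
    {t : ℝ} (ht0 : 0 < t) (ht1 : t < 1) (htC : t * C < 1) :
    BijOn (fun x => x + t • h x) (ball 0 ρ) (ball 0 ρ) := by
  have hI := lipschitzWith_indicator_closedBall hL h0
  set H := (closedBall (0 : E) ρ).indicator h with hH
  have hHin : ∀ x ∈ ball (0 : E) ρ, H x = h x := fun x hx =>
    indicator_of_mem (ball_subset_closedBall hx) h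
  have hHout : ∀ x ∉ ball (0 : E) ρ, H x = 0 := by
    intro x hx
    by_cases hx' : x ∈ closedBall (0 : E) ρ
    · rw [hH, indicator_of_mem hx']
      apply h0
      rw [mem_ball, not_lt] at hx
      exact le_antisymm hx' hx
    · exact indicator_of_notMem hx' h
  refine ⟨?_, ?_, ?_⟩
  · intro x hx
    have hx' := hm x (ball_subset_closedBall hx)
    rw [mem_ball_zero_iff] at *
    rw [mem_closedBall_zero_iff] at hx'
    have : x + t • h x = (1 - t) • x + t • (x + h x) := by module
    change ‖x + t • h x‖ < ρ
    rw [this]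
    calc ‖(1 - t) • x + t • (x + h x)‖ ≤ ‖(1 - t) • x‖ + ‖t • (x + h x)‖ := norm_add_le _ _
      _ = (1 - t) * ‖x‖ + t * ‖x + h x‖ := by
        rw [norm_smul, norm_smul, Real.norm_of_nonneg ht0.le,
          Real.norm_of_nonneg (sub_pos.2 ht1).le]
      _ < ρ := by nlinarith
  · intro x hx y hy hxy
    have h1 := hL.dist_le_mul x (ball_subset_closedBall hx) y (ball_subset_closedBall hy)
    by_contra hne
    have hpos : 0 < dist x y := dist_pos.2 hne
    have h2 : x - y = t • (h y - h x) := by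
      have : x + t • h x = y + t • h y := hxy
      rw [smul_sub, sub_eq_sub_iff_add_eq_add, this, add_comm]
    have h3 : dist x y = t * dist (h x) (h y) := by
      rw [dist_eq_norm, h2, norm_smul, Real.norm_of_nonneg ht0.le, ← dist_eq_norm, dist_comm]
    nlinarith
  · intro y hy
    have hcontr : ContractingWith ⟨t * C, by positivity⟩ (fun x => y - t • H x) := by
      refine ⟨by exact_mod_cast htC, LipschitzWith.of_dist_le_mul fun x z => ?_⟩
      rw [dist_sub_left, dist_smul₀, Real.norm_of_nonneg ht0.le]
      have := hI.dist_le_mul x z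
      change _ ≤ t * C * dist x z
      nlinarith
    have hfix := hcontr.fixedPoint_isFixedPt
    set x := hcontr.fixedPoint _
    have hx : y - t • H x = x := hfix
    -- Outside the ball `H` vanishes, so the fixed point would be `y`, which lies inside.
    have hxb : x ∈ ball (0 : E) ρ := by
      by_contra hxb
      rw [hHout x hxb, smul_zero, sub_zero] at hx
      exact hxb (hx ▸ hy)
    refine ⟨x, hxb, ?_⟩
    rw [hHin x hxb] at hx
    change x + t • h x = y
    exact (sub_eq_iff_eq_add.1 hx).symm

end Brouwer

/-! ### Change of variables and the no-retraction theorem. -/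

section Brouwer

/-- No `1 + s • A` with `s` in `[0, 1]` has a kernel, so the determinant keeps the sign it has at `s
= 0`. -/
theorem det_one_add_pos {E : Type*} [NormedAddCommGroup E] [NormedSpace ℝ E]
    [FiniteDimensional ℝ E] {A : E →L[ℝ] E} (hA : ‖A‖ < 1) : 0 < (1 + A).det := by
  have hne : ∀ s ∈ Icc (0 : ℝ) 1, (1 + s • A).det ≠ 0 := by
    intro s hs h
    obtain ⟨x, hx, hx0⟩ := (Submodule.ne_bot_iff _).1 (LinearMap.bot_lt_ker_of_det_eq_zero h).ne'
    have hx1 : x + s • A x = 0 := hx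
    have h1 : ‖x‖ = s * ‖A x‖ := by
      rw [eq_neg_of_add_eq_zero_left hx1, norm_neg, norm_smul, Real.norm_of_nonneg hs.1,
        ← eq_neg_of_add_eq_zero_left hx1]
    have h2 := A.le_opNorm x
    have h3 : 0 < ‖x‖ := norm_pos_iff.2 hx0
    nlinarith [hs.1, hs.2, norm_nonneg (A x)]
  have hc : ContinuousOn (fun s : ℝ => (1 + s • A).det) (Icc 0 1) :=
    (ContinuousLinearMap.continuous_det.comp (by fun_prop : Continuous fun s : ℝ => 1 + s • A)).continuousOn
  by_contra! hle
  obtain ⟨s, hs, h⟩ := intermediate_value_Icc' zero_le_one hc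
    (show (0 : ℝ) ∈ Icc _ _ by
      refine ⟨by simpa using hle, ?_⟩
      have : (1 : E →L[ℝ] E).det = 1 := LinearMap.det_id
      simp [this])
  exact hne s hs h

variable {E : Type*} [NormedAddCommGroup E] [InnerProductSpace ℝ E]

/-- A differentiable map with values in a sphere has singular derivative. -/
theorem det_fderiv_eq_zero_of_norm_eq [FiniteDimensional ℝ E] {r : E → E} {x : E} {ρ : ℝ}
    (hρ : 0 < ρ) (hr : DifferentiableAt ℝ r x) (hn : ∀ᶠ y in 𝓝 x, ‖r y‖ = ρ) :
    (fderiv ℝ r x).det = 0 := by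
  by_contra h
  -- `‖r‖²` is locally constant, so `r x` is orthogonal to the range of the derivative; surjectivity
  -- would put `r x` in that range.
  have h1 : HasFDerivAt (fun y => inner ℝ (r y) (r y)) (0 : E →L[ℝ] ℝ) x := by
    refine (hasFDerivAt_const (ρ ^ 2) x).congr_of_eventuallyEq ?_
    filter_upwards [hn] with y hy
    rw [real_inner_self_eq_norm_sq, hy]
  have h2 := h1.unique (hr.hasFDerivAt.inner ℝ hr.hasFDerivAt)
  have hsurj : Function.Surjective (fderiv ℝ r x : E →ₗ[ℝ] E) :=
    (LinearMap.equivOfDetNeZero _ h).surjective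
  obtain ⟨v, hv⟩ := hsurj (r x)
  have h3 := congrArg (fun L : E →L[ℝ] ℝ => L v) h2
  have hv' : fderiv ℝ r x v = r x := hv
  simp [hv', hn.self_of_nhds] at h3
  exact (by positivity : 0 < ρ ^ 2 + ρ ^ 2).ne h3

theorem continuousOn_det_one_add_smul_fderiv {s : Set E} {h : E → E}
    (hd : ∀ x ∈ s, ContDiffAt ℝ 1 h x) (t : ℝ) :
    ContinuousOn (fun x => (1 + t • fderiv ℝ h x).det) s := by
  refine ContinuousLinearMap.continuous_det.comp_continuousOn ?_
  refine continuousOn_const.add (ContinuousOn.const_smul (fun x hx => ?_) t)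
  exact ((hd x hx).fderiv_right (m := 0) (by norm_num)).continuousAt.continuousWithinAt

variable [FiniteDimensional ℝ E]

/-- Change of variables for a bijection of the ball; the determinant is positive, so the absolute
value drops out. -/
theorem integral_det_one_add_smul_fderiv [MeasurableSpace E] [BorelSpace E] {ρ : ℝ} {C : NNReal} {h : E → E}
    (hd : ∀ x ∈ closedBall (0 : E) ρ, ContDiffAt ℝ 1 h x)
    (hL : LipschitzOnWith C h (closedBall 0 ρ)) (h0 : ∀ x ∈ sphere (0 : E) ρ, h x = 0)
    (hm : ∀ x ∈ closedBall (0 : E) ρ, x + h x ∈ closedBall (0 : E) ρ)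
    {t : ℝ} (ht0 : 0 < t) (ht1 : t < 1) (htC : t * C < 1) :
    ∫ x in ball (0 : E) ρ, (1 + t • fderiv ℝ h x).det = volume.real (ball (0 : E) ρ) := by
  have hbij := bijOn_ball_add_smul hL h0 hm ht0 ht1 htC
  have hf' : ∀ x ∈ ball (0 : E) ρ, HasFDerivWithinAt (fun x => x + t • h x)
      (1 + t • fderiv ℝ h x) (ball 0 ρ) x := by
    intro x hx
    have := ((hd x (ball_subset_closedBall hx)).differentiableAt one_ne_zero).hasFDerivAt
    exact ((hasFDerivAt_id x).add (this.const_smul t)).hasFDerivWithinAt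
  have key := integral_image_eq_integral_abs_det_fderiv_smul volume measurableSet_ball hf'
    hbij.injOn (fun _ => (1 : ℝ))
  rw [hbij.image_eq] at key
  simp only [smul_eq_mul, mul_one, integral_const, measureReal_restrict_apply_univ] at key
  rw [key]
  refine setIntegral_congr_fun measurableSet_ball fun x hx => ?_
  have hn : ‖t • fderiv ℝ h x‖ < 1 := by
    rw [norm_smul, Real.norm_of_nonneg ht0.le]
    have := norm_fderiv_le_of_lipschitzOn ℝ (closedBall_mem_nhds_of_mem hx) hL
    nlinarith
  exact (abs_of_pos (det_one_add_pos hn)).symm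

/-- There is no `C¹` retraction of a closed ball onto its boundary sphere. -/
theorem no_contDiff_retraction {ρ : ℝ} (hρ : 0 < ρ) {r : E → E}
    (hd : ∀ x ∈ closedBall (0 : E) ρ, ContDiffAt ℝ 1 r x)
    (hr : MapsTo r (closedBall 0 ρ) (sphere 0 ρ)) (hfix : ∀ x ∈ sphere (0 : E) ρ, r x = x) :
    False := by
  borelize E
  set h : E → E := fun x => r x - x with hh
  have hhd : ∀ x ∈ closedBall (0 : E) ρ, ContDiffAt ℝ 1 h x :=
    fun x hx => (hd x hx).sub contDiffAt_id
  obtain ⟨C, hL⟩ := ContDiffOn.exists_lipschitzOnWith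
    (fun x hx => (hhd x hx).contDiffWithinAt) one_ne_zero (convex_closedBall (0 : E) ρ)
    (isCompact_closedBall 0 ρ)
  have h0 : ∀ x ∈ sphere (0 : E) ρ, h x = 0 := fun x hx => by simp [hh, hfix x hx]
  have hm : ∀ x ∈ closedBall (0 : E) ρ, x + h x ∈ closedBall (0 : E) ρ := fun x hx => by
    simpa [hh] using sphere_subset_closedBall (hr hx)
  obtain ⟨m, t, c, ht, hc, hdet⟩ := exists_det_one_add_eq_sum E
    (show (0 : ℝ) < 1 / (C + 1) by positivity)
  have htC : ∀ i, t i < 1 ∧ t i * C < 1 := by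
    intro i
    have h1 := (ht i).2
    rw [lt_div_iff₀ (by positivity)] at h1
    have h2 := (ht i).1
    have h3 : (0 : ℝ) ≤ C := C.2
    exact ⟨by nlinarith, by nlinarith⟩
  have hzero : ∫ x in ball (0 : E) ρ, (1 + fderiv ℝ h x).det = 0 := by
    refine (setIntegral_congr_fun measurableSet_ball (g := fun _ => (0 : ℝ)) fun x hx => ?_).trans
      (by simp)
    have hdx := (hd x (ball_subset_closedBall hx)).differentiableAt one_ne_zero
    have : 1 + fderiv ℝ h x = fderiv ℝ r x := by
      rw [hh, fderiv_fun_sub hdx differentiableAt_fun_id, fderiv_fun_id]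
      exact add_sub_cancel _ _
    simp only [this]
    refine det_fderiv_eq_zero_of_norm_eq hρ hdx ?_
    filter_upwards [closedBall_mem_nhds_of_mem hx] with y hy
    simpa using hr hy
  have hint : ∀ i, IntegrableOn (fun x => c i * (1 + t i • fderiv ℝ h x).det) (ball (0 : E) ρ) :=
    fun i => (((continuousOn_det_one_add_smul_fderiv hhd (t i)).integrableOn_compact
      (isCompact_closedBall 0 ρ)).mono_set ball_subset_closedBall).const_mul (c i)
  -- Each small-`t` integral is the volume and the weights sum to `1`, so the volume would be zero.
  rw [setIntegral_congr_fun measurableSet_ball fun x _ => hdet (fderiv ℝ h x),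
    integral_finsetSum _ fun i _ => hint i] at hzero
  simp_rw [integral_const_mul, fun i => integral_det_one_add_smul_fderiv hhd hL h0 hm
    (ht i).1 (htC i).1 (htC i).2] at hzero
  rw [← Finset.sum_mul, hc, one_mul] at hzero
  have hpos : 0 < volume.real (ball (0 : E) ρ) :=
    ENNReal.toReal_pos (measure_ball_pos volume 0 hρ).ne' measure_ball_lt_top.ne
  exact hpos.ne' hzero

end Brouwer

/-! ### Brouwer's theorem: the `C¹` case, then the continuous case. -/

section Brouwer

variable {E : Type*} [NormedAddCommGroup E] [InnerProductSpace ℝ E] [FiniteDimensional ℝ E]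

/-- Brouwer's theorem for a `C¹` self-map of the space with bounded range. -/
theorem exists_fixedPoint_of_contDiff_of_norm_lt {f : E → E} (hf : ContDiff ℝ 1 f) {ρ : ℝ}
    (hρ : 0 < ρ) (hb : ∀ x, ‖f x‖ < ρ) : ∃ x, f x = x := by
  by_contra! hne
  let w : E → E := fun x => x - f x
  have hw : ContDiff ℝ 1 w := contDiff_id.sub hf
  have hw0 : ∀ x, 0 < ‖w x‖ ^ 2 := fun x => by
    have : w x ≠ 0 := sub_ne_zero.2 (hne x).symm
    positivity
  -- `l x` is the larger root of `‖x + l • w x‖² = ρ²`, with `D` a quarter of the discriminant: the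
  -- ray from `f x` through `x` leaves the ball at `x + l x • w x`.
  let D : E → ℝ := fun x => inner ℝ x (w x) ^ 2 + ‖w x‖ ^ 2 * (ρ ^ 2 - ‖x‖ ^ 2)
  let l : E → ℝ := fun x => (-inner ℝ x (w x) + √(D x)) / ‖w x‖ ^ 2
  have hinner : ∀ x, ‖x‖ = ρ → 0 < inner ℝ x (w x) := by
    intro x hx
    have h1 : inner ℝ x (f x) ≤ ‖x‖ * ‖f x‖ := real_inner_le_norm _ _
    have h2 := hb x
    simp only [w, inner_sub_right, real_inner_self_eq_norm_sq]
    rw [hx] at *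
    nlinarith
  have hDpos : ∀ x ∈ closedBall (0 : E) ρ, 0 < D x := by
    intro x hx
    rw [mem_closedBall_zero_iff] at hx
    rcases hx.lt_or_eq with hx | hx
    · have : 0 < ρ ^ 2 - ‖x‖ ^ 2 := by nlinarith [norm_nonneg x]
      have := mul_pos (hw0 x) this
      simp only [D]
      positivity
    · have := hinner x hx
      simp only [D, hx, sub_self, mul_zero, add_zero]
      positivity
  refine no_contDiff_retraction hρ (r := fun x => x + l x • w x) ?_ ?_ ?_
  · intro x hx
    have hD : ContDiff ℝ 1 D :=
      ((contDiff_id.inner ℝ hw).pow 2).add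
        ((hw.norm_sq ℝ).mul (contDiff_const.sub (contDiff_id.norm_sq ℝ)))
    have hl : ContDiffAt ℝ 1 l x :=
      ((contDiff_id.inner ℝ hw).neg.contDiffAt.add (hD.contDiffAt.sqrt (hDpos x hx).ne')).div
        (hw.norm_sq ℝ).contDiffAt (hw0 x).ne'
    exact contDiffAt_id.add (hl.smul hw.contDiffAt)
  · intro x hx
    have hs := Real.sq_sqrt (hDpos x hx).le
    have hl : l x * ‖w x‖ ^ 2 = -inner ℝ x (w x) + √(D x) := div_mul_cancel₀ _ (hw0 x).ne'
    have hsq : ‖x + l x • w x‖ ^ 2 = ρ ^ 2 := by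
      rw [norm_add_sq_real, norm_smul, inner_smul_right, mul_pow, Real.norm_eq_abs, sq_abs]
      apply mul_left_cancel₀ (hw0 x).ne'
      have hD : D x = inner ℝ x (w x) ^ 2 + ‖w x‖ ^ 2 * (ρ ^ 2 - ‖x‖ ^ 2) := rfl
      have : √(D x) = l x * ‖w x‖ ^ 2 + inner ℝ x (w x) := by linarith
      rw [this] at hs
      linear_combination hs + hD
    rw [mem_sphere_zero_iff_norm]
    exact (sq_eq_sq₀ (norm_nonneg _) hρ.le).1 hsq
  · intro x hx
    rw [mem_sphere_zero_iff_norm] at hx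
    have : l x = 0 := by
      simp only [l, D, hx, sub_self, mul_zero, add_zero, Real.sqrt_sq (hinner x hx).le]
      simp
    simp [this]

/-- Brouwer's theorem for a continuous self-map of the space with bounded range. -/
theorem exists_fixedPoint_of_continuous_of_norm_le {f : E → E} (hf : Continuous f) {ρ : ℝ}
    (hb : ∀ x, ‖f x‖ ≤ ρ) : ∃ x, f x = x := by
  have hρ : 0 ≤ ρ := (norm_nonneg _).trans (hb 0)
  -- A positive minimum of the displacement contradicts a fixed point of a close enough `C¹`
  -- approximation; radius `ρ + 1` contains the values of any approximation within `1`.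
  obtain ⟨x, -, hx⟩ := (isCompact_closedBall (0 : E) (ρ + 1)).exists_isMinOn
    ⟨0, by simp; linarith⟩ (f := fun x => ‖f x - x‖) (by fun_prop)
  refine ⟨x, ?_⟩
  by_contra hne
  have hpos : 0 < ‖f x - x‖ := norm_pos_iff.2 (sub_ne_zero.2 hne)
  set ε := min 1 ‖f x - x‖
  have hε : 0 < ε := lt_min one_pos hpos
  obtain ⟨g, hg, hgf, -⟩ := hf.exists_contDiff_approx 1 (ε := fun _ => ε) continuous_const
    fun _ => hε
  have hgn : ∀ y, ‖g y‖ < ρ + 1 := fun y => by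
    have h1 := hgf y
    rw [dist_eq_norm] at h1
    have h2 := norm_le_norm_add_norm_sub (f y) (g y)
    have h3 := norm_sub_rev (f y) (g y)
    have := hb y
    have : ε ≤ 1 := min_le_left _ _
    linarith
  obtain ⟨y, hy⟩ := exists_fixedPoint_of_contDiff_of_norm_lt
    (show ContDiff ℝ 1 g from mod_cast hg) (by linarith) hgn
  have hyb : y ∈ closedBall (0 : E) (ρ + 1) := by
    rw [mem_closedBall_zero_iff, ← hy]
    exact (hgn y).le
  have h1 : ‖f x - x‖ ≤ ‖f y - y‖ := hx hyb
  have h2 := hgf y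
  rw [hy, dist_eq_norm, norm_sub_rev] at h2
  exact absurd (h2.trans_le (min_le_right _ _)) (not_lt.2 h1)

end Brouwer

/-! ### Transfer to the simplex and the PageRank equation. -/

/-- A continuous map that sends the simplex `levelSet n u` to itself has a fixed point there. -/
theorem MultilinearPageRank.exists_fixedPoint_levelSet {n : ℕ} (hn : 0 < n) {u : ℝ} (hu : 0 < u)
    {F : (Fin n → ℝ) → Fin n → ℝ} (hF : Continuous F)
    (hm : MapsTo F (levelSet n u) (levelSet n u)) : ∃ x ∈ levelSet n u, F x = x := by
  have hn' : (0 : ℝ) < n := by exact_mod_cast hn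
  -- Take positive parts and spread any deficit evenly: the total is at least `u > 0`, so rescaling
  -- gives a continuous retraction `p` onto the simplex.
  let y : (Fin n → ℝ) → Fin n → ℝ := fun x i => max (x i) 0 + max (u - ∑ j, max (x j) 0) 0 / n
  have hys : ∀ x, ∑ i, y x i = ∑ i, max (x i) 0 + max (u - ∑ j, max (x j) 0) 0 := by
    intro x
    simp only [y, Finset.sum_add_distrib, Finset.sum_const, Finset.card_univ, Fintype.card_fin,
      nsmul_eq_mul]
    rw [mul_div_cancel₀ _ hn'.ne']
  have hypos : ∀ x, 0 < ∑ i, y x i := by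
    intro x
    rw [hys]
    linarith [le_max_left (u - ∑ j, max (x j) 0) 0]
  let p : (Fin n → ℝ) → Fin n → ℝ := fun x i => u / (∑ j, y x j) * y x i
  have hpc : Continuous p := by
    refine continuous_pi fun i => ?_
    have h1 : Continuous fun x => ∑ j, y x j := by fun_prop
    exact (continuous_const.div h1 fun x => (hypos x).ne').mul (by fun_prop)
  have hpm : ∀ x, p x ∈ levelSet n u := by
    intro x
    refine ⟨?_, fun i => ?_⟩
    · simp only [one_dotProduct, p]
      rw [← Finset.mul_sum, div_mul_cancel₀ _ (hypos x).ne']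
    · have : 0 ≤ y x i := by simp only [y]; positivity
      have := hypos x
      simp only [p, Pi.zero_apply]
      positivity
  have hpf : ∀ x ∈ levelSet n u, p x = x := by
    rintro x ⟨hx1, hx0⟩
    rw [one_dotProduct] at hx1
    have h1 : ∀ i, max (x i) 0 = x i := fun i => max_eq_left (hx0 i)
    have hy : y x = x := by
      ext i
      simp [y, h1, hx1]
    ext i
    simp only [p, hy, hx1]
    rw [div_self hu.ne', one_mul]
  let e := EuclideanSpace.equiv (Fin n) ℝ
  have hbdd : ∀ z ∈ levelSet n u, ‖e.symm z‖ ≤ ‖(e.symm : (Fin n → ℝ) →L[ℝ] EuclideanSpace ℝ (Fin n))‖ * u := by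
    rintro z ⟨hz1, hz0⟩
    refine ((e.symm : (Fin n → ℝ) →L[ℝ] EuclideanSpace ℝ (Fin n)).le_opNorm z).trans ?_
    refine mul_le_mul_of_nonneg_left ?_ (norm_nonneg _)
    refine (pi_norm_le_iff_of_nonneg hu.le).2 fun i => ?_
    rw [Real.norm_of_nonneg (hz0 i), ← hz1, one_dotProduct]
    exact Finset.single_le_sum (fun j _ => hz0 j) (Finset.mem_univ i)
  obtain ⟨x, hx⟩ := exists_fixedPoint_of_continuous_of_norm_le
    (f := fun x => e.symm (F (p (e x))))
    (e.symm.continuous.comp (hF.comp (hpc.comp e.continuous)))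
    (fun x => hbdd _ (hm (hpm _)))
  have hx' : F (p (e x)) = e x := e.symm_apply_eq.1 hx
  -- The fixed point is a value of `F` on the simplex, hence lies there and is fixed by `p`.
  have hmem : e x ∈ levelSet n u := hx' ▸ hm (hpm _)
  exact ⟨e x, hmem, by rwa [hpf _ hmem] at hx'⟩

theorem mainTheorem3 (n : ℕ) (α : ℝ) (hα0 : 0 < α) (hα1 : α < 1)
    (v : Fin n → ℝ) (hv : 0 ≤ v) (hv1 : (1 : Fin n → ℝ) ⬝ᵥ v = 1)
    (R : Matrix (Fin n) (Fin n × Fin n) ℝ) (hR : ∀ i p, 0 ≤ R i p)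
    (hR1 : (1 : Fin n → ℝ) ᵥ* R = (1 : Fin n × Fin n → ℝ)) :
    (∀ u : ℝ, u = 1 ∨ u = (1 - α) / α →
      Set.MapsTo (MultilinearPageRank.G α R v)
        (MultilinearPageRank.levelSet n u) (MultilinearPageRank.levelSet n u)) ∧
    (∃ x : Fin n → ℝ, 0 ≤ x ∧ MultilinearPageRank.IsSolution α R v x ∧
      (1 : Fin n → ℝ) ⬝ᵥ x = 1) ∧
    (∃ x : Fin n → ℝ, 0 ≤ x ∧ MultilinearPageRank.IsSolution α R v x ∧
      (1 : Fin n → ℝ) ⬝ᵥ x = (1 - α) / α) := by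
  have hmaps : ∀ u : ℝ, u = 1 ∨ u = (1 - α) / α →
      Set.MapsTo (MultilinearPageRank.G α R v)
        (MultilinearPageRank.levelSet n u) (MultilinearPageRank.levelSet n u) := by
    rintro u hu x ⟨hx1, hx0⟩
    refine ⟨?_, ?_⟩
    · have hk : (1 : Fin n × Fin n → ℝ) ⬝ᵥ MultilinearPageRank.kronVec x x = u * u := by
        rw [← hx1, one_dotProduct, one_dotProduct, Finset.sum_mul_sum, Fintype.sum_prod_type]
        rfl
      rw [MultilinearPageRank.G, dotProduct_add, dotProduct_smul, dotProduct_smul, hv1,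
        Matrix.dotProduct_mulVec, hR1, hk, smul_eq_mul, smul_eq_mul]
      -- What remains is `α u² + (1 - α) = u`, with roots `1` and `(1 - α) / α`.
      rcases hu with rfl | rfl
      · ring
      · field_simp
        ring
    · intro i
      have h1 : 0 ≤ (R *ᵥ MultilinearPageRank.kronVec x x) i :=
        Finset.sum_nonneg fun p _ => mul_nonneg (hR i p) (mul_nonneg (hx0 p.1) (hx0 p.2))
      have h2 : 0 ≤ v i := hv i
      have h3 : 0 ≤ 1 - α := by linarith
      simp only [MultilinearPageRank.G, Pi.add_apply, Pi.smul_apply, smul_eq_mul, Pi.zero_apply]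
      positivity
  have hn : 0 < n := by
    rcases Nat.eq_zero_or_pos n with rfl | h
    · simp at hv1
    · exact h
  have hG : Continuous (MultilinearPageRank.G α R v) := by
    have : Continuous fun x : Fin n → ℝ => MultilinearPageRank.kronVec x x :=
      continuous_pi fun p => (continuous_apply p.1).mul (continuous_apply p.2)
    exact ((continuous_const.matrix_mulVec this).const_smul α).add continuous_const
  have hsol : ∀ u : ℝ, 0 < u → (u = 1 ∨ u = (1 - α) / α) →
      ∃ x : Fin n → ℝ, 0 ≤ x ∧ MultilinearPageRank.IsSolution α R v x ∧
        (1 : Fin n → ℝ) ⬝ᵥ x = u := by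
    intro u hu0 hu
    obtain ⟨x, hx, hfix⟩ := MultilinearPageRank.exists_fixedPoint_levelSet hn hu0 hG (hmaps u hu)
    exact ⟨x, hx.2, hfix.symm, hx.1⟩
  exact ⟨hmaps, hsol 1 one_pos (Or.inl rfl),
    hsol _ (div_pos (by linarith) hα0) (Or.inr rfl)⟩
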